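/- Robots are points of the Euclidean plane. A configuration $C$ is the finite multiset of the positions of all robots, and $|C|$ is the number of robots. An algorithm assigns to every configuration $C$ and every position $P\in C$ a probability distribution with finite support on the plane; the support $\mathrm{Pos}_{\mathcal A}(C,P)$ is the set of possible destinations of a robot at $P$, and $k_{\mathcal A}(C,P)=|\mathrm{Pos}_{\mathcal A}(C,P)|$ is the destination function. In each fully synchronous round all robots observe the current configuration $C$ and then, independently, each robot at a position $P$ moves to a destination drawn from the distribution assigned to $(C,P)$. A configuration is scattered if no two robots share a position. $\mathcal A$ is a scattering algorithm if from every initial configuration a scattered configuration is reached almost surely after finitely many rounds; it is canonical if each of its distributions is uniform on $\mathrm{Pos}_{\mathcal A}(C,P)$ and $\mathrm{Pos}_{\mathcal A}(C,P)\cap \mathrm{Pos}_{\mathcal A}(C,Q)=\emptyset$ for distinct positions $P,Q\in C$. A choice among $k$ destinations uses $\log_2 k$ random bits, and bits used by a robot that is alone at its position are not counted. Let $W_{\mathcal A}(n)\in[0,\infty]$ be the supremum, over all initial configurations of $n$ robots, of the expected total number of random bits used before the robots are scattered. Theorem. Let $\mathcal A$ be a canonical scattering algorithm whose destination function is polynomially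 bounded in the number of robots: there are $K,n_0\in\mathbb N$ and $c\in\mathbb R$ with $k_{\mathcal A}(C,P)\le c\,|C|^K$ for all configurations $C$ with $|C|\ge n_0$ and all $P\in C$. Then the expected number of random bits that $\mathcal A$ uses to scatter $n$ robots is $O(n\log n)$: there is a constant $c'$ with $W_{\mathcal A}(n)\le c'\,n\log_2 n$ for all $n\ge n_0$. Consequently $\mathcal A$ is random bit optimal: for every scattering algorithm $\mathcal B$, canonical or not, $W_{\mathcal A}(n)=O(W_{\mathcal B}(n))$ as $n\to\infty$. -/

import Mathlib

open MeasureTheory ProbabilityTheory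
open scoped ENNReal NNReal

noncomputable section

namespace Robots

/-- The Euclidean plane in which the robots move. -/
abbrev Plane : Type := EuclideanSpace ℝ (Fin 2)

/-- An (oblivious) mobile robot algorithm. A robot that observes the configuration `C` (the multiset
of the positions of all robots) from the position `P` moves to a destination drawn from `dest C P`.
A single choice has only finitely many possible outcomes. -/
structure Algorithm where
  dest : Multiset Plane → Plane → PMF Plane
  finite_support : ∀ C P, (dest C P).support.Finite

/-- The positions of `n` (labelled) robots. -/
def Placement (n : ℕ) : Type := Fin n → Plane

/-- Placements carry the discrete σ-algebra: algorithms are arbitrary functions of the observation. -/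
instance (n : ℕ) : MeasurableSpace (Placement n) := ⊤

/-- The configuration (multiset of positions) of a placement. -/
def Placement.config {n : ℕ} (x : Placement n) : Multiset Plane :=
  Finset.univ.val.map (fun i : Fin n => x i)

/-- No two robots share a position. -/
def Placement.Scattered {n : ℕ} (x : Placement n) : Prop :=
  ∀ i j : Fin n, x i = x j → i = j

/-- Robot `i` is located at a point of multiplicity. -/
def Placement.AtMultiplicity {n : ℕ} (x : Placement n) (i : Fin n) : Prop :=
  ∃ j : Fin n, j ≠ i ∧ x j = x i

namespace Algorithm

variable (A : Algorithm)

/-- The set of possible destinations of a robot that observes `C` from `P`. -/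
def pos (C : Multiset Plane) (P : Plane) : Finset Plane := (A.finite_support C P).toFinset

/-- The destination function: the number of possible destinations. -/
def numDest (C : Multiset Plane) (P : Plane) : ℕ := (A.pos C P).card

/-- The algorithm is canonical: every robot chooses uniformly among its possible destinations, and
the possible destinations of robots at different positions are different. -/
structure IsCanonical : Prop where
  uniform : ∀ C : Multiset Plane, ∀ P ∈ C, ∀ D ∈ A.pos C P,
    A.dest C P D = (A.numDest C P : ℝ≥0∞)⁻¹
  disjoint : ∀ C : Multiset Plane, ∀ P ∈ C, ∀ Q ∈ C, P ≠ Q → Disjoint (A.pos C P) (A.pos C Q)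

theorem hasSum_step {n : ℕ} (x : Placement n) :
    HasSum (fun y : Placement n => ∏ i : Fin n, A.dest x.config (x i) (y i)) 1 := by
  classical
  have h1 : ∀ i : Fin n, ∑ D ∈ A.pos x.config (x i), A.dest x.config (x i) D = 1 := by
    intro i
    rw [← (A.dest x.config (x i)).tsum_coe]
    refine (tsum_eq_sum fun D hD => ?_).symm
    simpa [pos, PMF.mem_support_iff] using hD
  have h2 : ∑ y ∈ Fintype.piFinset (fun i : Fin n => A.pos x.config (x i)),
      ∏ i : Fin n, A.dest x.config (x i) (y i) = 1 := by
    rw [← Finset.prod_univ_sum]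
    simp [h1]
  rw [← h2]
  change HasSum (fun y : Fin n → Plane => ∏ i : Fin n, A.dest x.config (x i) (y i)) _
  refine hasSum_sum_of_ne_finset_zero fun y hy => ?_
  rw [Fintype.mem_piFinset, not_forall] at hy
  obtain ⟨i, hi⟩ := hy
  refine Finset.prod_eq_zero (Finset.mem_univ i) ?_
  simpa [pos, PMF.mem_support_iff] using hi

/-- One fully synchronous round from the placement `x`: all robots observe the same configuration
and independently move to a random destination. -/
def step {n : ℕ} (x : Placement n) : PMF (Placement n) :=
  ⟨fun y => ∏ i : Fin n, A.dest x.config (x i) (y i), A.hasSum_step x⟩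

/-- The transition kernel of one round. -/
def stepKernel (n : ℕ) : Kernel (Placement n) (Placement n) where
  toFun x := (A.step x).toMeasure
  measurable' := measurable_from_top

instance (n : ℕ) : IsMarkovKernel (A.stepKernel n) :=
  ⟨fun x => PMF.toMeasure.isProbabilityMeasure (A.step x)⟩

/-- The law of the next placement given the history of the execution: it depends only on the
current placement. -/
def historyKernel (n t : ℕ) : Kernel (Π _ : Finset.Iic t, Placement n) (Placement n) :=
  (A.stepKernel n).comap (fun h => h ⟨t, Finset.mem_Iic.2 le_rfl⟩) (measurable_pi_apply _)

instance (n t : ℕ) : IsMarkovKernel (A.historyKernel n t) := by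
  unfold historyKernel; infer_instance

/-- The law of the (infinite) fully synchronous execution of `A` with initial placement `x₀`. -/
def execution {n : ℕ} (x₀ : Placement n) : Measure (ℕ → Placement n) :=
  Kernel.trajMeasure (X := fun _ => Placement n) (Measure.dirac x₀) (A.historyKernel n)

/-- `A` is a scattering algorithm: from every initial placement of any number of robots, almost
surely no two robots share a position after finitely many rounds. -/
def IsScattering : Prop :=
  ∀ (n : ℕ) (x₀ : Placement n), ∀ᵐ ω ∂(A.execution x₀), ∃ t, (ω t).Scattered

open Classical in
/-- The number of random bits used in one round: a choice among `k` destinations takes `log₂ k`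
bits; robots that are alone at their position are not counted. -/
def roundBits {n : ℕ} (x : Placement n) : ℝ≥0∞ :=
  ∑ i : Fin n, if x.AtMultiplicity i then
    ENNReal.ofReal (Real.logb 2 (A.numDest x.config (x i))) else 0

open Classical in
/-- The number of random bits used in an execution before the robots are scattered. -/
def bitsToScatter {n : ℕ} (ω : ℕ → Placement n) : ℝ≥0∞ :=
  ∑' t : ℕ, if ∀ s ≤ t, ¬ (ω s).Scattered then A.roundBits (ω t) else 0

/-- The random bit complexity: the largest expected number of random bits that `A` uses to scatter
`n` robots, over all initial placements. -/
def bitComplexity (n : ℕ) : ℝ≥0∞ :=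
  ⨆ x₀ : Placement n, ∫⁻ ω, A.bitsToScatter ω ∂(A.execution x₀)

/-- `A` is random bit optimal: up to a constant factor, no scattering algorithm (canonical or not)
has a smaller random bit complexity. -/
def RandomBitOptimal : Prop :=
  ∀ B : Algorithm, B.IsScattering → ∃ (c : ℝ≥0) (n₀ : ℕ), ∀ n : ℕ, n₀ ≤ n →
    A.bitComplexity n ≤ c * B.bitComplexity n

end Algorithm

end Robots

end

/-! ### The law of an execution and of a single round. -/

namespace Robots

/-! Upper bound: in a canonical algorithm robots at different positions never meet, and two robots
sharing a position with `k` destinations meet again with probability `1/k`. So the expected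
multiplicity of a robot drops from `m` to at most `1 + (m - 1)/k`. The potential `3 log₂ m + 4L(1 -
1/m)` is concave in `m`, and by Jensen its expected drop pays for the `log₂ k` bits of the choice
(`potential_add_logb_le`): the logarithm pays when `k ≤ m`, the bounded term when `k > m`. Each
robot starts with potential at most `3 log₂ n + 4L`, where `L = O(log n)` by the polynomial bound.

Lower bound, for any algorithm: the permutations preserving a placement measure the symmetry still
to be broken. A round reduces the logarithm of their number by at most the bits it uses
(`symmetryBits_le_add`). From all robots at one point this logarithm must fall from `log₂ n!` to
`0`, and Stirling compares `log₂ n!` with `n log₂ n`. -/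

instance (n : ℕ) : MeasurableSingletonClass (Placement n) := ⟨fun _ => trivial⟩

theorem measurable_placement {n : ℕ} {β : Type*} [MeasurableSpace β] (f : Placement n → β) :
    Measurable f := measurable_from_top

namespace Algorithm

variable (A : Algorithm)

instance {n : ℕ} (x₀ : Placement n) : IsProbabilityMeasure (A.execution x₀) := by
  unfold execution; infer_instance

/-- The Markov property. The weight `F` on the past allows restriction to events such as "not yet
scattered". -/
theorem lintegral_execution_succ {n : ℕ} (x₀ : Placement n) (t : ℕ)
    (F : (Π _ : Finset.Iic t, Placement n) → ℝ≥0∞) (hF : Measurable F)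
    (f : Placement n → ℝ≥0∞) :
    ∫⁻ ω, F (Preorder.frestrictLe t ω) * f (ω (t + 1)) ∂(A.execution x₀) =
      ∫⁻ ω, F (Preorder.frestrictLe t ω) * ∫⁻ y, f y ∂(A.step (ω t)).toMeasure
        ∂(A.execution x₀) := by
  have hf := measurable_placement f
  have hG : Measurable fun p : (Π _ : Finset.Iic t, Placement n) × Placement n =>
      F p.1 * f p.2 := (hF.comp measurable_fst).mul (hf.comp measurable_snd)
  have h := Kernel.map_frestrictLe_trajMeasure_compProd_eq_map_trajMeasure
    (X := fun _ => Placement n) (κ := A.historyKernel n) (μ₀ := Measure.dirac x₀) (a := t)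
  have h2 := congrArg (fun μ => ∫⁻ p, F p.1 * f p.2 ∂μ) h
  beta_reduce at h2
  rw [lintegral_map hG (by fun_prop), Measure.lintegral_compProd hG,
    lintegral_map hG.lintegral_kernel_prod_right' (by fun_prop)] at h2
  refine h2.symm.trans (lintegral_congr fun ω => ?_)
  have hker : A.historyKernel n t (Preorder.frestrictLe t ω) = (A.step (ω t)).toMeasure := rfl
  rw [hker]
  exact lintegral_const_mul (F (Preorder.frestrictLe t ω)) hf

theorem map_zero_execution {n : ℕ} (x₀ : Placement n) :
    (A.execution x₀).map (fun ω => ω 0) = Measure.dirac x₀ := by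
  have h0 : (A.execution x₀).map (Preorder.frestrictLe 0) =
      (Measure.dirac x₀).map (MeasurableEquiv.piUnique
        (fun _ : Finset.Iic 0 => Placement n)).symm := by
    unfold execution Kernel.trajMeasure
    rw [Measure.map_comp _ _ (by fun_prop), Kernel.traj_map_frestrictLe, Kernel.partialTraj_self]
    exact Measure.id_comp
  have h1 : (fun ω : ℕ → Placement n => ω 0) =
      (fun h : Π _ : Finset.Iic 0, Placement n => h ⟨0, Finset.mem_Iic.2 le_rfl⟩) ∘
        Preorder.frestrictLe 0 := rfl
  rw [h1, ← Measure.map_map (by fun_prop) (by fun_prop), h0,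
    Measure.map_map (by fun_prop) (by fun_prop)]
  exact Measure.map_id

theorem lintegral_execution_zero {n : ℕ} (x₀ : Placement n) (f : Placement n → ℝ≥0∞) :
    ∫⁻ ω, f (ω 0) ∂(A.execution x₀) = f x₀ := by
  have hf := measurable_placement f
  rw [← lintegral_map (g := fun ω : ℕ → Placement n => ω 0) hf (by fun_prop),
    map_zero_execution, lintegral_dirac]

theorem mem_pos_iff {C : Multiset Plane} {P D : Plane} : D ∈ A.pos C P ↔ A.dest C P D ≠ 0 := by
  simp [pos, PMF.mem_support_iff]

/-- The possible placements after one round. -/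
noncomputable def succs {n : ℕ} (x : Placement n) : Finset (Placement n) :=
  Fintype.piFinset fun i : Fin n => A.pos x.config (x i)

theorem mem_succs {n : ℕ} {x y : Placement n} :
    y ∈ A.succs x ↔ ∀ i, y i ∈ A.pos x.config (x i) :=
  Fintype.mem_piFinset

theorem card_succs {n : ℕ} (x : Placement n) :
    (A.succs x).card = ∏ i, A.numDest x.config (x i) :=
  Fintype.card_piFinset _

theorem step_apply {n : ℕ} (x y : Placement n) :
    A.step x y = ∏ i : Fin n, A.dest x.config (x i) (y i) := rfl

theorem support_step {n : ℕ} (x : Placement n) : (A.step x).support = A.succs x := by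
  ext y
  simp [PMF.mem_support_iff, step_apply, mem_succs, mem_pos_iff, Finset.prod_eq_zero_iff]

theorem lintegral_step {n : ℕ} (x : Placement n) (f : Placement n → ℝ≥0∞) :
    ∫⁻ y, f y ∂(A.step x).toMeasure = ∑ y ∈ A.succs x, f y * A.step x y := by
  rw [← PMF.restrict_toMeasure_support, support_step, lintegral_finset]
  simp only [PMF.toMeasure_apply_singleton _ _ (measurableSet_singleton _)]

theorem numDest_pos (C : Multiset Plane) (P : Plane) : 0 < A.numDest C P := by
  obtain ⟨D, hD⟩ := (A.dest C P).support_nonempty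
  exact Finset.card_pos.2 ⟨D, (A.mem_pos_iff).2 hD⟩

theorem _root_.Robots.Placement.mem_config {n : ℕ} (x : Placement n) (i : Fin n) :
    x i ∈ x.config := by
  simpa [Placement.config] using ⟨i, rfl⟩

theorem _root_.Robots.Placement.card_config {n : ℕ} (x : Placement n) :
    x.config.card = n := by
  simp [Placement.config]

end Algorithm

end Robots

/-! ### Multiplicities and the potential of one robot. -/

namespace Robots

open Classical in
/-- The number of robots that share the position of robot `i`, including `i` itself. -/
noncomputable def Placement.mult {n : ℕ} (x : Placement n) (i : Fin n) : ℕ :=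
  (Finset.univ.filter fun j : Fin n => x j = x i).card

theorem Placement.one_le_mult {n : ℕ} (x : Placement n) (i : Fin n) : 1 ≤ x.mult i :=
  Finset.card_pos.2 ⟨i, by simp⟩

theorem Placement.mult_le {n : ℕ} (x : Placement n) (i : Fin n) : x.mult i ≤ n := by
  classical
  simpa [Placement.mult] using
    Finset.card_le_univ (Finset.univ.filter fun j : Fin n => x j = x i)

theorem Placement.atMultiplicity_iff {n : ℕ} (x : Placement n) (i : Fin n) :
    x.AtMultiplicity i ↔ 2 ≤ x.mult i := by
  classical
  change _ ↔ 1 < x.mult i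
  unfold Placement.mult
  rw [Finset.one_lt_card_iff_nontrivial]
  constructor
  · rintro ⟨j, hj, hx⟩
    exact ⟨j, by simpa using hx, i, by simp, hj⟩
  · intro h
    obtain ⟨j, hj, hne⟩ := h.exists_ne i
    exact ⟨j, hne, by simpa using hj⟩

/-- The placement after robot `j` has moved to `d`. -/
def Placement.move {n : ℕ} (x : Placement n) (j : Fin n) (d : Plane) : Placement n :=
  fun l => if l = j then d else x l

/-- The contribution of one robot to the potential: `m` is the multiplicity of its position and `L`
a bound for the number of bits of a single choice. -/
noncomputable def potential (L m : ℝ) : ℝ := 3 * Real.logb 2 m + 4 * L * (1 - m⁻¹)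

theorem potential_nonneg {L m : ℝ} (hL : 0 ≤ L) (hm : 1 ≤ m) : 0 ≤ potential L m := by
  have h1 : 0 ≤ Real.logb 2 m := Real.logb_nonneg one_lt_two hm
  have h2 : 0 ≤ 1 - m⁻¹ := sub_nonneg.2 (inv_le_one_of_one_le₀ hm)
  unfold potential; positivity

theorem potential_le {L m N : ℝ} (hL : 0 ≤ L) (hm : 1 ≤ m) (hN : m ≤ N) :
    potential L m ≤ 3 * Real.logb 2 N + 4 * L := by
  have h1 : Real.logb 2 m ≤ Real.logb 2 N :=
    Real.logb_le_logb_of_le one_lt_two (by linarith) hN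
  have h2 : 0 ≤ m⁻¹ := by positivity
  unfold potential
  nlinarith

/-- The potential lies below its tangents. -/
theorem potential_le_tangent {L : ℝ} (hL : 0 ≤ L) {μ : ℝ} (hμ : 0 < μ) :
    ∃ s : ℝ, 0 ≤ s ∧ ∀ m : ℝ, 0 < m → potential L m ≤ potential L μ + s * (m - μ) := by
  have hl : 0 < Real.log 2 := Real.log_pos one_lt_two
  -- The slope is the derivative of the potential at `μ`.
  refine ⟨3 / (Real.log 2 * μ) + 4 * L / μ ^ 2, by positivity, fun m hm => ?_⟩
  have h1 : Real.logb 2 m ≤ Real.logb 2 μ + (m - μ) / (Real.log 2 * μ) := by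
    have h := Real.log_le_sub_one_of_pos (div_pos hm hμ)
    rw [Real.log_div hm.ne' hμ.ne'] at h
    have : Real.logb 2 m - Real.logb 2 μ ≤ (m / μ - 1) / Real.log 2 := by
      unfold Real.logb
      rw [← sub_div]
      gcongr
    have e : (m / μ - 1) / Real.log 2 = (m - μ) / (Real.log 2 * μ) := by field_simp
    linarith
  have h2 : 1 - m⁻¹ ≤ 1 - μ⁻¹ + (m - μ) / μ ^ 2 := by
    have : 1 - μ⁻¹ + (m - μ) / μ ^ 2 - (1 - m⁻¹) = (m - μ) ^ 2 / (m * μ ^ 2) := by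
      field_simp; ring
    have h3 : 0 ≤ (m - μ) ^ 2 / (m * μ ^ 2) := by positivity
    linarith
  unfold potential
  calc 3 * Real.logb 2 m + 4 * L * (1 - m⁻¹)
      ≤ 3 * (Real.logb 2 μ + (m - μ) / (Real.log 2 * μ)) +
        4 * L * (1 - μ⁻¹ + (m - μ) / μ ^ 2) := by gcongr
    _ = _ := by ring

/-- A choice among `k` destinations decreases the potential by the number of bits used. -/
theorem potential_add_logb_le {L : ℝ} {m k : ℕ} (hm : 2 ≤ m) (hk : 1 ≤ k)
    (hkL : Real.logb 2 k ≤ L) :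
    potential L (1 + (m - 1) / k) + Real.logb 2 k ≤ potential L m := by
  have hL : 0 ≤ L := (Real.logb_nonneg one_lt_two (by exact_mod_cast hk)).trans hkL
  have hm' : (2 : ℝ) ≤ m := by exact_mod_cast hm
  have hk1 : (1 : ℝ) ≤ k := by exact_mod_cast hk
  have hμ0 : 0 < 1 + ((m : ℝ) - 1) / k := by
    have : 0 ≤ ((m : ℝ) - 1) / k := div_nonneg (by linarith) (by linarith)
    linarith
  have hμm : 1 + ((m : ℝ) - 1) / k ≤ m := by
    have : ((m : ℝ) - 1) / k ≤ m - 1 := div_le_self (by linarith) hk1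
    linarith
  have hk0 : (0 : ℝ) < k := by linarith
  rcases le_or_gt k m with hkm | hkm
  · have hkm' : (k : ℝ) ≤ m := by exact_mod_cast hkm
    -- This is the exponentiated form of what the logarithmic term must pay. The coefficient 3 comes
    -- from here: exponent 2 fails at `k = m = 2`.
    have key : (1 + ((m : ℝ) - 1) / k) ^ 3 * k ≤ m ^ 3 := by
      -- The ratio of new to old multiplicity is largest at `m = k`, which leaves an inequality in
      -- `k` alone.
      have h1 : 1 + ((m : ℝ) - 1) / k ≤ m * ((2 * k - 1) / k ^ 2) := by
        rw [← sub_nonneg]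
        have : (m : ℝ) * ((2 * k - 1) / k ^ 2) - (1 + ((m : ℝ) - 1) / k) =
            (m - k) * (k - 1) / k ^ 2 := by field_simp; ring
        rw [this]
        exact div_nonneg (mul_nonneg (by linarith) (by linarith)) (by positivity)
      have h2 : (2 * (k : ℝ) - 1) ^ 3 ≤ k ^ 5 := by
        rcases Nat.lt_or_ge k 3 with h | h
        · interval_cases k <;> norm_num
        · have h3 : (3 : ℝ) ≤ k := by exact_mod_cast h
          calc (2 * (k : ℝ) - 1) ^ 3 ≤ (2 * k) ^ 3 :=
                pow_le_pow_left₀ (by linarith) (by linarith) 3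
            _ = 8 * k ^ 3 := by ring
            _ ≤ k ^ 2 * k ^ 3 := by gcongr; nlinarith
            _ = k ^ 5 := by ring
      calc (1 + ((m : ℝ) - 1) / k) ^ 3 * k
          ≤ ((m : ℝ) * ((2 * k - 1) / k ^ 2)) ^ 3 * k := by gcongr
        _ = (m : ℝ) ^ 3 * ((2 * k - 1) ^ 3 / k ^ 5) := by field_simp
        _ ≤ (m : ℝ) ^ 3 * 1 := by
          gcongr
          exact div_le_one_of_le₀ h2 (by positivity)
        _ = (m : ℝ) ^ 3 := mul_one _
    have hlog := Real.logb_le_logb_of_le one_lt_two (by positivity) key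
    rw [Real.logb_mul (by positivity) (by positivity), Real.logb_pow, Real.logb_pow] at hlog
    have hinv : (m : ℝ)⁻¹ ≤ (1 + ((m : ℝ) - 1) / k)⁻¹ := inv_anti₀ hμ0 hμm
    have h4 : 4 * L * (1 - (1 + ((m : ℝ) - 1) / k)⁻¹) ≤ 4 * L * (1 - (m : ℝ)⁻¹) := by gcongr
    unfold potential
    push_cast at hlog
    linarith
  · have hkm' : (m : ℝ) + 1 ≤ k := by exact_mod_cast hkm
    have hlog := Real.logb_le_logb_of_le one_lt_two hμ0 hμm
    -- For `k > m ≥ 2` the reciprocal rises by at least `1/4`, so the coefficient `4 * L` releases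
    -- at least `L ≥ log₂ k`.
    have h5 : 1 ≤ 4 * ((1 + ((m : ℝ) - 1) / k)⁻¹ - (m : ℝ)⁻¹) := by
      have e : 4 * ((1 + ((m : ℝ) - 1) / k)⁻¹ - (m : ℝ)⁻¹) =
          4 * ((m - 1) * (k - 1)) / (m * (k + m - 1)) := by
        have : (k : ℝ) + m - 1 ≠ 0 := by linarith
        have e2 : 1 + ((m : ℝ) - 1) / k = (k + m - 1) / k := by field_simp; ring
        rw [e2]
        field_simp
        ring
      rw [e, one_le_div (mul_pos (by linarith) (by linarith))]
      have ha : (m : ℝ) ≤ 2 * (m - 1) := by linarith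
      have hb : (k : ℝ) + m - 1 ≤ 2 * (k - 1) := by linarith
      calc (m : ℝ) * (k + m - 1) ≤ (2 * (m - 1)) * (2 * (k - 1)) :=
            mul_le_mul ha hb (by linarith) (by linarith)
        _ = 4 * ((m - 1) * (k - 1)) := by ring
    have h6 : L * 1 ≤ L * (4 * ((1 + ((m : ℝ) - 1) / k)⁻¹ - (m : ℝ)⁻¹)) := by gcongr
    unfold potential
    linarith

/-! ### Expected decrease of the potential and the upper bound. -/

namespace Algorithm

variable (A : Algorithm)

/-- A potential that decreases in expectation by the number of bits used in a round bounds the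
expected number of bits used in an execution. -/
theorem lintegral_bitsToScatter_le {n : ℕ} (Φ : Placement n → ℝ≥0∞)
    (hΦ : ∀ x, ∫⁻ y, Φ y ∂(A.step x).toMeasure + A.roundBits x ≤ Φ x) (x₀ : Placement n) :
    ∫⁻ ω, A.bitsToScatter ω ∂(A.execution x₀) ≤ Φ x₀ := by
  classical
  have hr : ∀ t, Measurable fun ω : ℕ → Placement n => A.roundBits (ω t) := fun t =>
    (measurable_placement A.roundBits).comp (measurable_pi_apply t)
  have hsum : ∀ N, ∑ t ∈ Finset.range N, ∫⁻ ω, A.roundBits (ω t) ∂(A.execution x₀) +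
      ∫⁻ ω, Φ (ω N) ∂(A.execution x₀) ≤ Φ x₀ := by
    intro N
    induction N with
    | zero => simp [lintegral_execution_zero]
    | succ N ih =>
      refine le_trans ?_ ih
      rw [Finset.sum_range_succ, add_assoc]
      gcongr
      have h := A.lintegral_execution_succ x₀ N (fun _ => 1) measurable_const Φ
      simp only [one_mul] at h
      rw [h, ← lintegral_add_left (hr N)]
      refine lintegral_mono fun ω => ?_
      rw [add_comm]
      exact hΦ _
  calc ∫⁻ ω, A.bitsToScatter ω ∂(A.execution x₀)
      ≤ ∫⁻ ω, ∑' t, A.roundBits (ω t) ∂(A.execution x₀) := by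
        -- Bits of all rounds, even after scattering, are counted; the potential bounds these too.
        refine lintegral_mono fun ω => ENNReal.tsum_le_tsum fun t => ?_
        split_ifs
        · exact le_rfl
        · exact zero_le
    _ = ∑' t, ∫⁻ ω, A.roundBits (ω t) ∂(A.execution x₀) :=
        lintegral_tsum fun t => (hr t).aemeasurable
    _ ≤ Φ x₀ := by
        rw [ENNReal.tsum_eq_iSup_nat]
        exact iSup_le fun N => le_self_add.trans (hsum N)

variable {A}

theorem IsCanonical.step_apply_of_mem (h : A.IsCanonical) {n : ℕ} {x y : Placement n}
    (hy : y ∈ A.succs x) : A.step x y = ((A.succs x).card : ℝ≥0∞)⁻¹ := by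
  have hinv : (∏ i, (A.numDest x.config (x i) : ℝ≥0∞))⁻¹ =
      ∏ i, (A.numDest x.config (x i) : ℝ≥0∞)⁻¹ := by
    refine ENNReal.prod_inv_distrib fun i _ j _ _ => ?_
    simp [(A.numDest_pos x.config (x i)).ne']
  rw [step_apply, card_succs, Nat.cast_prod, hinv]
  exact Finset.prod_congr rfl fun i _ => h.uniform _ _ (x.mem_config i) _ (A.mem_succs.1 hy i)

theorem card_succs_pos {n : ℕ} (x : Placement n) : 0 < (A.succs x).card := by
  rw [card_succs]
  exact Finset.prod_pos fun i _ => A.numDest_pos _ _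

-- Where `j` lands with `i`, the destination of `j` is recovered from that of `i`; so overwriting it
-- by an arbitrary destination is injective. For uniform choices this bounds the meeting probability
-- by `1/k`.
open Classical in
theorem card_succs_filter_eq_mul_le {n : ℕ} (x : Placement n) {i j : Fin n} (hij : j ≠ i) :
    ((A.succs x).filter fun y => y j = y i).card * A.numDest x.config (x j) ≤
      (A.succs x).card := by
  unfold numDest
  rw [← Finset.card_product]
  refine Finset.card_le_card_of_injOn
    (fun p => p.1.move j p.2) ?_ ?_
  · rintro ⟨y, d⟩ hp
    simp only [Finset.coe_product, Set.mem_prod, Finset.mem_coe, Finset.mem_filter] at hp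
    rw [Finset.mem_coe, mem_succs]
    intro l
    rcases eq_or_ne l j with rfl | hl
    · simpa [Placement.move] using hp.2
    · simpa [Placement.move, hl] using A.mem_succs.1 hp.1.1 l
  · rintro ⟨y, d⟩ hp ⟨z, e⟩ hq heq
    simp only [Finset.coe_product, Set.mem_prod, Finset.mem_coe, Finset.mem_filter] at hp hq
    have hd : d = e := by simpa [Placement.move] using congrFun heq j
    have hne : ∀ l, l ≠ j → y l = z l := fun l hl => by simpa [Placement.move, hl] using congrFun heq l
    refine Prod.ext (funext fun l => ?_) hd
    rcases eq_or_ne l j with rfl | hl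
    · exact hp.1.2.trans ((hne i hij.symm).trans hq.1.2.symm)
    · exact hne l hl

theorem IsCanonical.sum_mult_le (h : A.IsCanonical) {n : ℕ} (x : Placement n) (i : Fin n) :
    ∑ y ∈ A.succs x, (y.mult i : ℝ) ≤
      (A.succs x).card * (1 + ((x.mult i : ℝ) - 1) / A.numDest x.config (x i)) := by
  classical
  set k : ℝ := (A.numDest x.config (x i) : ℝ) with hkdef
  have hk : 0 < k := Nat.cast_pos.2 (A.numDest_pos _ _)
  set S := A.succs x
  have h1 : ∑ y ∈ S, (y.mult i : ℝ) = ∑ j : Fin n, ((S.filter fun y => y j = y i).card : ℝ) := by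
    have : ∑ y ∈ S, y.mult i = ∑ j : Fin n, (S.filter fun y => y j = y i).card := by
      simp only [Placement.mult, Finset.card_filter]
      convert Finset.sum_comm (s := S) (t := Finset.univ)
        (f := fun (y : Placement n) j => if y j = y i then 1 else 0)
    exact_mod_cast this
  -- The term at `j = i` corrects `1/k` to `1`, since a robot always meets itself.
  have h2 : ∀ j : Fin n, ((S.filter fun y => y j = y i).card : ℝ) ≤
      S.card * ((if x j = x i then 1 / k else 0) + if j = i then 1 - 1 / k else 0) := by
    intro j
    rcases eq_or_ne j i with rfl | hji
    · simp
    rw [if_neg hji, add_zero]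
    split_ifs with hx
    · have := card_succs_filter_eq_mul_le (A := A) x hji
      rw [hx] at this
      rw [mul_one_div, le_div_iff₀ hk, hkdef, ← Nat.cast_mul]
      exact Nat.cast_le.2 this
    · rw [mul_zero, Finset.filter_false_of_mem, Finset.card_empty, Nat.cast_zero]
      intro y hy he
      exact Finset.disjoint_left.1 (h.disjoint _ _ (x.mem_config j) _ (x.mem_config i) hx)
        (A.mem_succs.1 hy j) (he ▸ A.mem_succs.1 hy i)
  rw [h1]
  refine (Finset.sum_le_sum fun j _ => h2 j).trans (le_of_eq ?_)
  have h3 : (∑ j : Fin n, if x j = x i then 1 / k else 0) = x.mult i * (1 / k) := by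
    have h5 : x.mult i = (Finset.univ.filter fun j : Fin n => x j = x i).card := by
      unfold Placement.mult
      congr!
    have h4 := Finset.sum_const (s := Finset.univ.filter fun j : Fin n => x j = x i) (1 / k)
    rw [nsmul_eq_mul, Finset.sum_filter] at h4
    rw [h5]
    convert h4
  rw [← Finset.mul_sum, Finset.sum_add_distrib, Finset.sum_ite_eq' Finset.univ i, h3,
    if_pos (Finset.mem_univ i)]
  ring

/-- Jensen's inequality via the tangent at `μ`. Its slope is nonnegative, so an upper bound on the
mean multiplicity suffices. -/
theorem IsCanonical.sum_potential_le (h : A.IsCanonical) {n : ℕ} (x : Placement n) (i : Fin n)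
    {L : ℝ} (hL : 0 ≤ L) :
    ∑ y ∈ A.succs x, potential L (y.mult i) ≤ (A.succs x).card *
      potential L (1 + ((x.mult i : ℝ) - 1) / A.numDest x.config (x i)) := by
  set μ := 1 + ((x.mult i : ℝ) - 1) / A.numDest x.config (x i) with hμdef
  have hm : (1 : ℝ) ≤ x.mult i := by exact_mod_cast x.one_le_mult i
  have hμ : 0 < μ := by
    have : 0 ≤ ((x.mult i : ℝ) - 1) / A.numDest x.config (x i) :=
      div_nonneg (by linarith) (Nat.cast_nonneg _)
    linarith
  obtain ⟨s, hs, hle⟩ := potential_le_tangent hL hμ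
  calc ∑ y ∈ A.succs x, potential L (y.mult i)
      ≤ ∑ y ∈ A.succs x, (potential L μ + s * (y.mult i - μ)) :=
        Finset.sum_le_sum fun y _ => hle _ (by exact_mod_cast y.one_le_mult i)
    _ = (A.succs x).card * potential L μ +
        s * (∑ y ∈ A.succs x, (y.mult i : ℝ) - (A.succs x).card * μ) := by
        rw [Finset.sum_add_distrib, Finset.sum_const, nsmul_eq_mul, ← Finset.mul_sum,
          Finset.sum_sub_distrib, Finset.sum_const, nsmul_eq_mul]
    _ ≤ (A.succs x).card * potential L μ := by
        have := h.sum_mult_le x i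
        nlinarith

theorem IsCanonical.lintegral_potential_add_roundBits_le (h : A.IsCanonical) {n : ℕ}
    (x : Placement n) {L : ℝ} (hL : 0 ≤ L)
    (hx : ∀ i, Real.logb 2 (A.numDest x.config (x i)) ≤ L) :
    ∫⁻ y, ENNReal.ofReal (∑ i, potential L (y.mult i)) ∂(A.step x).toMeasure + A.roundBits x ≤
      ENNReal.ofReal (∑ i, potential L (x.mult i)) := by
  classical
  have hS : (0 : ℝ) < (A.succs x).card := by exact_mod_cast card_succs_pos x
  have hpos : ∀ (y : Placement n) i, 0 ≤ potential L (y.mult i) := fun y i =>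
    potential_nonneg hL (by exact_mod_cast y.one_le_mult i)
  have hb : ∀ i, 0 ≤ if x.AtMultiplicity i then Real.logb 2 (A.numDest x.config (x i)) else 0 := by
    intro i
    split_ifs
    · exact Real.logb_nonneg one_lt_two (by exact_mod_cast A.numDest_pos _ _)
    · exact le_rfl
  have h1 : A.roundBits x = ENNReal.ofReal
      (∑ i, if x.AtMultiplicity i then Real.logb 2 (A.numDest x.config (x i)) else 0) := by
    rw [ENNReal.ofReal_sum_of_nonneg fun i _ => hb i]
    refine Finset.sum_congr rfl fun i _ => ?_
    split_ifs <;> simp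
  have h2 : ∫⁻ y, ENNReal.ofReal (∑ i, potential L (y.mult i)) ∂(A.step x).toMeasure =
      ENNReal.ofReal ((∑ y ∈ A.succs x, ∑ i, potential L (y.mult i)) / (A.succs x).card) := by
    rw [lintegral_step, div_eq_mul_inv, Finset.sum_mul, ENNReal.ofReal_sum_of_nonneg]
    · refine Finset.sum_congr rfl fun y hy => ?_
      rw [h.step_apply_of_mem hy, ENNReal.ofReal_mul (Finset.sum_nonneg fun i _ => hpos y i),
        ENNReal.ofReal_inv_of_pos hS, ENNReal.ofReal_natCast]
    · intro y _
      exact mul_nonneg (Finset.sum_nonneg fun i _ => hpos y i) (by positivity)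
  rw [h1, h2, ← ENNReal.ofReal_add
    (div_nonneg (Finset.sum_nonneg fun y _ => Finset.sum_nonneg fun i _ => hpos y i) hS.le)
    (Finset.sum_nonneg fun i _ => hb i)]
  refine ENNReal.ofReal_le_ofReal ?_
  rw [Finset.sum_comm, Finset.sum_div, ← Finset.sum_add_distrib]
  refine Finset.sum_le_sum fun i _ => ?_
  have h3 := h.sum_potential_le x i hL
  rw [← div_le_iff₀' hS] at h3
  refine (add_le_add_left h3 _).trans ?_
  split_ifs with hi
  · exact potential_add_logb_le ((x.atMultiplicity_iff i).1 hi) (A.numDest_pos _ _) (hx i)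
  · have : x.mult i = 1 := le_antisymm
      (by rw [x.atMultiplicity_iff] at hi; omega) (x.one_le_mult i)
    simp [this]

theorem IsCanonical.bitComplexity_le (h : A.IsCanonical) {n : ℕ} {L : ℝ} (hL : 0 ≤ L)
    (hk : ∀ (x : Placement n) i, Real.logb 2 (A.numDest x.config (x i)) ≤ L) :
    A.bitComplexity n ≤ ENNReal.ofReal (n * (3 * Real.logb 2 n + 4 * L)) := by
  refine iSup_le fun x₀ => (A.lintegral_bitsToScatter_le
    (fun y => ENNReal.ofReal (∑ i, potential L (y.mult i)))
    (fun x => h.lintegral_potential_add_roundBits_le x hL (hk x)) x₀).trans ?_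
  refine ENNReal.ofReal_le_ofReal ?_
  calc ∑ i, potential L (x₀.mult i) ≤ ∑ _i : Fin n, (3 * Real.logb 2 n + 4 * L) :=
        Finset.sum_le_sum fun i _ => potential_le hL (by exact_mod_cast x₀.one_le_mult i)
          (by exact_mod_cast x₀.mult_le i)
    _ = n * (3 * Real.logb 2 n + 4 * L) := by simp [mul_add]

theorem bitComplexity_eq_zero {n : ℕ} (hn : n ≤ 1) : A.bitComplexity n = 0 := by
  have : Subsingleton (Fin n) := Fin.subsingleton_iff_le_one.2 hn
  refine le_antisymm (iSup_le fun x₀ => ?_) zero_le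
  refine (A.lintegral_bitsToScatter_le (fun _ => 0) (fun x => ?_) x₀).trans le_rfl
  have : ∀ i, ¬ x.AtMultiplicity i := fun i ⟨j, hj, _⟩ => hj (Subsingleton.elim _ _)
  simp [roundBits, this]

theorem IsCanonical.exists_bitComplexity_le (h : A.IsCanonical) {K n₀ : ℕ} {c : ℝ}
    (hk : ∀ (C : Multiset Plane) (P : Plane), n₀ ≤ C.card → P ∈ C →
      (A.numDest C P : ℝ) ≤ c * (C.card : ℝ) ^ K) :
    ∃ c' : ℝ, ∀ n : ℕ, n₀ ≤ n →
      A.bitComplexity n ≤ ENNReal.ofReal (c' * ((n : ℝ) * Real.logb 2 n)) := by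
  have hc0 : 0 ≤ Real.logb 2 (max c 1) := Real.logb_nonneg one_lt_two (le_max_right _ _)
  -- Here `L = log₂ (max c 1) + K log₂ n`; its constant part is absorbed using `log₂ n ≥ 1`, hence
  -- the separate case `n < 2`.
  refine ⟨3 + 4 * (Real.logb 2 (max c 1) + K), fun n hn => ?_⟩
  rcases Nat.lt_or_ge n 2 with hn2 | hn2
  · rw [bitComplexity_eq_zero (by omega)]
    exact zero_le
  have hn' : (2 : ℝ) ≤ n := by exact_mod_cast hn2
  have hlog : 1 ≤ Real.logb 2 n := by
    rw [Real.le_logb_iff_rpow_le one_lt_two (by linarith)]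
    simpa using hn'
  have hL : ∀ (x : Placement n) i, Real.logb 2 (A.numDest x.config (x i)) ≤
      Real.logb 2 (max c 1) + K * Real.logb 2 n := by
    intro x i
    have h1 := hk x.config (x i) (by rwa [x.card_config]) (x.mem_config i)
    rw [x.card_config] at h1
    have h2 : (A.numDest x.config (x i) : ℝ) ≤ max c 1 * (n : ℝ) ^ K :=
      h1.trans (by gcongr; exact le_max_left _ _)
    have h3 := Real.logb_le_logb_of_le one_lt_two
      (by exact_mod_cast A.numDest_pos x.config (x i)) h2
    rwa [Real.logb_mul (by positivity) (by positivity), Real.logb_pow] at h3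
  refine (h.bitComplexity_le (by positivity) hL).trans (ENNReal.ofReal_le_ofReal ?_)
  have : Real.logb 2 (max c 1) ≤ Real.logb 2 (max c 1) * Real.logb 2 n :=
    le_mul_of_one_le_right hc0 hlog
  calc (n : ℝ) * (3 * Real.logb 2 n + 4 * (Real.logb 2 (max c 1) + K * Real.logb 2 n))
      ≤ n * (3 * Real.logb 2 n +
        4 * (Real.logb 2 (max c 1) * Real.logb 2 n + K * Real.logb 2 n)) := by gcongr
    _ = _ := by ring

end Algorithm

end Robots

/-! ### Symmetries of placements and the lower bound. -/

namespace Robots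

open Classical in
/-- The permutations of the robots that do not change the placement. -/
noncomputable def Placement.stab {n : ℕ} (x : Placement n) : Finset (Equiv.Perm (Fin n)) :=
  Finset.univ.filter fun σ => ∀ i, x (σ i) = x i

theorem Placement.mem_stab {n : ℕ} {x : Placement n} {σ : Equiv.Perm (Fin n)} :
    σ ∈ x.stab ↔ ∀ i, x (σ i) = x i := by simp [Placement.stab]

theorem Placement.card_stab_pos {n : ℕ} (x : Placement n) : 0 < x.stab.card :=
  Finset.card_pos.2 ⟨1, Placement.mem_stab.2 fun _ => rfl⟩

theorem Placement.card_stab_le {n : ℕ} (x : Placement n) : x.stab.card ≤ n.factorial := by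
  simpa [Fintype.card_perm] using Finset.card_le_univ x.stab

theorem Placement.Scattered.card_stab {n : ℕ} {x : Placement n} (hx : x.Scattered) :
    x.stab.card = 1 := by
  rw [Finset.card_eq_one]
  refine ⟨1, Finset.ext fun σ => ?_⟩
  rw [Placement.mem_stab, Finset.mem_singleton]
  refine ⟨fun h => Equiv.ext fun i => hx _ _ (h i), ?_⟩
  rintro rfl i
  rfl

/-- The number of bits needed to separate the robots. -/
noncomputable def Placement.symmetryBits {n : ℕ} (x : Placement n) : ℝ≥0∞ :=
  ENNReal.ofReal (Real.logb 2 x.stab.card)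

theorem Placement.Scattered.symmetryBits {n : ℕ} {x : Placement n} (hx : x.Scattered) :
    x.symmetryBits = 0 := by
  simp [Placement.symmetryBits, hx.card_stab]

theorem Placement.symmetryBits_le {n : ℕ} (x : Placement n) :
    x.symmetryBits ≤ ENNReal.ofReal (Real.logb 2 n.factorial) :=
  ENNReal.ofReal_le_ofReal (Real.logb_le_logb_of_le one_lt_two
    (by exact_mod_cast x.card_stab_pos) (by exact_mod_cast x.card_stab_le))

/-- All robots at the same position. -/
noncomputable def gathered (n : ℕ) : Placement n := fun _ => 0

theorem symmetryBits_gathered (n : ℕ) :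
    (gathered n).symmetryBits = ENNReal.ofReal (Real.logb 2 n.factorial) := by
  have : (gathered n).stab = Finset.univ :=
    Finset.eq_univ_iff_forall.2 fun σ => Placement.mem_stab.2 fun _ => rfl
  rw [Placement.symmetryBits, this, Finset.card_univ, Fintype.card_perm, Fintype.card_fin]

namespace Algorithm

variable (B : Algorithm)

open Classical in
/-- The random choices of a round break at most as many symmetries as there are joint outcomes. -/
theorem card_stab_le_mul {n : ℕ} {x y : Placement n} (hy : y ∈ B.succs x) :
    x.stab.card ≤ y.stab.card *
      ∏ i, if x.AtMultiplicity i then B.numDest x.config (x i) else 1 := by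
  -- A symmetry of `x` fixes every robot that is alone, so `y ∘ σ` can differ from `y` only at
  -- robots whose choices are counted.
  let T : Finset (Fin n → Plane) := Fintype.piFinset fun i =>
    if x.AtMultiplicity i then B.pos x.config (x i) else {y i}
  have hT : T.card = ∏ i, if x.AtMultiplicity i then B.numDest x.config (x i) else 1 := by
    rw [Fintype.card_piFinset]
    refine Finset.prod_congr rfl fun i _ => ?_
    split_ifs
    · rfl
    · simp
  rw [← hT, mul_comm]
  have hmaps : ∀ σ ∈ x.stab, (fun i => y (σ i) : Fin n → Plane) ∈ T := by
    intro σ hσ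
    rw [Placement.mem_stab] at hσ
    rw [Fintype.mem_piFinset]
    intro i
    split_ifs with hi
    · rw [← hσ i]
      exact B.mem_succs.1 hy (σ i)
    · rw [Finset.mem_singleton]
      by_contra hne
      exact hi ⟨σ i, fun h => hne (by rw [h]), hσ i⟩
  refine (Finset.card_le_mul_card_image_of_maps_to hmaps y.stab.card fun z _ => ?_).trans_eq
    (mul_comm _ _)
  rcases (x.stab.filter fun σ => (fun i => y (σ i) : Fin n → Plane) = z).eq_empty_or_nonempty
    with he | ⟨τ, hτ⟩
  · rw [he]
    exact Nat.zero_le _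
  -- If `y ∘ σ = y ∘ τ`, then `σ * τ⁻¹` preserves `y`: a fibre embeds in the stabilizer of `y`.
  · refine Finset.card_le_card_of_injOn (fun σ => σ * τ⁻¹) ?_
      fun σ _ σ' _ h => mul_right_cancel h
    intro σ hσ
    rw [Finset.mem_coe, Placement.mem_stab]
    intro i
    have h1 := (Finset.mem_filter.1 hσ).2.trans (Finset.mem_filter.1 hτ).2.symm
    simpa using congrFun h1 (τ⁻¹ i)

theorem symmetryBits_le_add {n : ℕ} {x y : Placement n} (hy : y ∈ B.succs x) :
    x.symmetryBits ≤ y.symmetryBits + B.roundBits x := by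
  classical
  have hk : ∀ i, (1 : ℝ) ≤ B.numDest x.config (x i) := fun i => by
    exact_mod_cast B.numDest_pos _ _
  have hpos : ∀ i, (0 : ℝ) < if x.AtMultiplicity i then (B.numDest x.config (x i) : ℝ) else 1 := by
    intro i
    split_ifs
    · linarith [hk i]
    · exact one_pos
  have h1 : B.roundBits x = ENNReal.ofReal (Real.logb 2
      (∏ i, if x.AtMultiplicity i then (B.numDest x.config (x i) : ℝ) else 1)) := by
    rw [Real.logb_prod _ _ fun i _ => (hpos i).ne', ENNReal.ofReal_sum_of_nonneg]
    · refine Finset.sum_congr rfl fun i _ => ?_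
      split_ifs <;> simp
    · intro i _
      split_ifs
      · exact Real.logb_nonneg one_lt_two (hk i)
      · simp
  have h2 : (x.stab.card : ℝ) ≤ y.stab.card *
      ∏ i, if x.AtMultiplicity i then (B.numDest x.config (x i) : ℝ) else 1 := by
    exact_mod_cast B.card_stab_le_mul hy
  have hx : (0 : ℝ) < x.stab.card := by exact_mod_cast x.card_stab_pos
  have hy0 : (0 : ℝ) < y.stab.card := by exact_mod_cast y.card_stab_pos
  have h3 := Real.logb_le_logb_of_le one_lt_two hx h2
  rw [Real.logb_mul hy0.ne' (Finset.prod_pos fun i _ => hpos i).ne'] at h3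
  rw [h1]
  exact (ENNReal.ofReal_le_ofReal h3).trans ENNReal.ofReal_add_le

theorem symmetryBits_le_lintegral_add {n : ℕ} (x : Placement n) :
    x.symmetryBits ≤ ∫⁻ y, y.symmetryBits ∂(B.step x).toMeasure + B.roundBits x := by
  have hae : ∀ᵐ y ∂(B.step x).toMeasure, x.symmetryBits ≤ y.symmetryBits + B.roundBits x := by
    rw [ae_iff, PMF.toMeasure_apply_eq_zero_iff _ MeasurableSpace.measurableSet_top,
      support_step, Set.disjoint_left]
    exact fun y hy h => h (B.symmetryBits_le_add hy)
  have : IsProbabilityMeasure (B.step x).toMeasure := PMF.toMeasure.isProbabilityMeasure _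
  calc x.symmetryBits = ∫⁻ _, x.symmetryBits ∂(B.step x).toMeasure := by simp
    _ ≤ ∫⁻ y, (y.symmetryBits + B.roundBits x) ∂(B.step x).toMeasure := lintegral_mono_ae hae
    _ = _ := by rw [lintegral_add_right _ measurable_const]; simp

/-- The executions in which the robots are not scattered up to time `t`. -/
def notScatteredUpTo (n t : ℕ) : Set (ℕ → Placement n) := {ω | ∀ s ≤ t, ¬ (ω s).Scattered}

theorem measurableSet_notScatteredUpTo (n t : ℕ) : MeasurableSet (notScatteredUpTo n t) := by
  have : notScatteredUpTo n t =
      ⋂ s, ⋂ _ : s ≤ t, (fun ω : ℕ → Placement n => ω s) ⁻¹' {x | ¬ x.Scattered} := by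
    ext ω; simp [notScatteredUpTo]
  rw [this]
  exact MeasurableSet.iInter fun s => MeasurableSet.iInter fun _ =>
    measurable_pi_apply s trivial

theorem setLIntegral_execution_succ {n : ℕ} (x₀ : Placement n) (t : ℕ)
    (f : Placement n → ℝ≥0∞) :
    ∫⁻ ω in notScatteredUpTo n t, f (ω (t + 1)) ∂(B.execution x₀) =
      ∫⁻ ω in notScatteredUpTo n t, ∫⁻ y, f y ∂(B.step (ω t)).toMeasure ∂(B.execution x₀) := by
  classical
  let S : Set (Π _ : Finset.Iic t, Placement n) := {h | ∀ s, ¬ (h s).Scattered}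
  have hS : MeasurableSet S := by
    have : S = ⋂ s, (fun h : Π _ : Finset.Iic t, Placement n => h s) ⁻¹'
        {x | ¬ x.Scattered} := by
      ext h; simp [S]
    rw [this]
    exact MeasurableSet.iInter fun s => measurable_pi_apply s trivial
  have hmem : ∀ ω : ℕ → Placement n,
      Preorder.frestrictLe t ω ∈ S ↔ ω ∈ notScatteredUpTo n t := by
    intro ω
    simp [S, notScatteredUpTo, Preorder.frestrictLe]
  have h := B.lintegral_execution_succ x₀ t (S.indicator 1)
    (measurable_one.indicator hS) f
  have hind : ∀ (ω : ℕ → Placement n) (a : (ℕ → Placement n) → ℝ≥0∞),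
      S.indicator 1 (Preorder.frestrictLe t ω) * a ω = (notScatteredUpTo n t).indicator a ω := by
    intro ω a
    simp only [Set.indicator_apply, hmem]
    split_ifs <;> simp
  rw [← lintegral_indicator (measurableSet_notScatteredUpTo n t),
    ← lintegral_indicator (measurableSet_notScatteredUpTo n t)]
  refine Eq.trans (lintegral_congr fun ω => (hind ω fun ω => f (ω (t + 1))).symm)
    (h.trans (lintegral_congr fun ω => hind ω fun ω => ∫⁻ y, f y ∂(B.step (ω t)).toMeasure))

/-- The two events differ only where the placement at `t + 1` is scattered, and there the integrand
vanishes. -/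
theorem setLIntegral_symmetryBits_succ {n : ℕ} (x₀ : Placement n) (t : ℕ) :
    ∫⁻ ω in notScatteredUpTo n (t + 1), (ω (t + 1)).symmetryBits ∂(B.execution x₀) =
      ∫⁻ ω in notScatteredUpTo n t, (ω (t + 1)).symmetryBits ∂(B.execution x₀) := by
  classical
  rw [← lintegral_indicator (measurableSet_notScatteredUpTo n t),
    ← lintegral_indicator (measurableSet_notScatteredUpTo n (t + 1))]
  refine lintegral_congr fun ω => ?_
  by_cases hs : (ω (t + 1)).Scattered
  · simp [Set.indicator_apply, hs.symmetryBits]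
  · have : ω ∈ notScatteredUpTo n (t + 1) ↔ ω ∈ notScatteredUpTo n t := by
      refine ⟨fun h s hst => h s (by omega), fun h s hst => ?_⟩
      rcases Nat.lt_or_ge t s with h' | h'
      · obtain rfl : s = t + 1 := by omega
        exact hs
      · exact h s h'
    simp only [Set.indicator_apply, this]

theorem symmetryBits_le_sum_add {n : ℕ} (x₀ : Placement n) (N : ℕ) :
    x₀.symmetryBits ≤ ∑ t ∈ Finset.range N,
        ∫⁻ ω in notScatteredUpTo n t, B.roundBits (ω t) ∂(B.execution x₀) +
      ∫⁻ ω in notScatteredUpTo n N, (ω N).symmetryBits ∂(B.execution x₀) := by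
  classical
  induction N with
  | zero =>
    rw [Finset.sum_range_zero, zero_add,
      ← lintegral_indicator (measurableSet_notScatteredUpTo n 0),
      ← B.lintegral_execution_zero x₀ Placement.symmetryBits]
    refine lintegral_mono fun ω => ?_
    by_cases hs : (ω 0).Scattered
    · simp [hs.symmetryBits]
    · have : ω ∈ notScatteredUpTo n 0 := fun s hs0 => by
        obtain rfl : s = 0 := by omega
        exact hs
      simp [this]
  | succ N ih =>
    refine ih.trans ?_
    rw [Finset.sum_range_succ, add_assoc, setLIntegral_symmetryBits_succ,
      setLIntegral_execution_succ]
    gcongr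
    have hr : Measurable fun ω : ℕ → Placement n => B.roundBits (ω N) :=
      (measurable_placement B.roundBits).comp (measurable_pi_apply N)
    rw [← lintegral_add_left hr]
    refine lintegral_mono fun ω => ?_
    rw [add_comm]
    exact B.symmetryBits_le_lintegral_add _

theorem lintegral_bitsToScatter {n : ℕ} (x₀ : Placement n) :
    ∫⁻ ω, B.bitsToScatter ω ∂(B.execution x₀) =
      ∑' t, ∫⁻ ω in notScatteredUpTo n t, B.roundBits (ω t) ∂(B.execution x₀) := by
  classical
  have hr : ∀ t, Measurable fun ω : ℕ → Placement n => B.roundBits (ω t) := fun t =>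
    (measurable_placement B.roundBits).comp (measurable_pi_apply t)
  simp_rw [← lintegral_indicator (measurableSet_notScatteredUpTo n _)]
  rw [← lintegral_tsum fun t =>
    ((hr t).indicator (measurableSet_notScatteredUpTo n t)).aemeasurable]
  refine lintegral_congr fun ω => tsum_congr fun t => ?_
  simp [Set.indicator_apply, notScatteredUpTo]

variable {B}

/-- After `N` rounds the unbroken symmetry contributes at most `log₂ n!` times the probability of
not having scattered, which tends to `0`. -/
theorem IsScattering.symmetryBits_le (hB : B.IsScattering) {n : ℕ} (x₀ : Placement n) :
    x₀.symmetryBits ≤ ∫⁻ ω, B.bitsToScatter ω ∂(B.execution x₀) := by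
  set M := ENNReal.ofReal (Real.logb 2 n.factorial)
  have hanti : Antitone (notScatteredUpTo n) := fun s t hst ω h r hr => h r (hr.trans hst)
  have hlim : Filter.Tendsto (fun N => B.execution x₀ (notScatteredUpTo n N)) Filter.atTop
      (nhds 0) := by
    have h0 : B.execution x₀ (⋂ N, notScatteredUpTo n N) = 0 := by
      refine measure_mono_null (fun ω hω => ?_) (ae_iff.1 (hB n x₀))
      rintro ⟨t, ht⟩
      exact Set.mem_iInter.1 hω t t le_rfl ht
    rw [← h0]
    exact tendsto_measure_iInter_atTop
      (fun N => (measurableSet_notScatteredUpTo n N).nullMeasurableSet) hanti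
      ⟨0, measure_ne_top _ _⟩
  have hlim2 : Filter.Tendsto (fun N => ∫⁻ ω, B.bitsToScatter ω ∂(B.execution x₀) +
      M * B.execution x₀ (notScatteredUpTo n N)) Filter.atTop
      (nhds (∫⁻ ω, B.bitsToScatter ω ∂(B.execution x₀))) := by
    have h := ENNReal.Tendsto.const_mul hlim (Or.inr (ENNReal.ofReal_ne_top : M ≠ ⊤))
    rw [mul_zero] at h
    simpa using h.const_add (∫⁻ ω, B.bitsToScatter ω ∂(B.execution x₀))
  refine ge_of_tendsto' hlim2 fun N => (B.symmetryBits_le_sum_add x₀ N).trans ?_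
  rw [lintegral_bitsToScatter]
  refine add_le_add (ENNReal.sum_le_tsum _) ?_
  refine (lintegral_mono fun ω => (ω N).symmetryBits_le).trans_eq ?_
  rw [setLIntegral_const]

theorem logb_factorial_ge {n : ℕ} (hn : 8 ≤ n) :
    (n : ℝ) * Real.logb 2 n ≤ 2 * Real.logb 2 n.factorial := by
  have hn' : (8 : ℝ) ≤ n := by exact_mod_cast hn
  have h1 := Stirling.le_log_factorial_stirling (n := n) (by omega)
  -- Then `n ≤ (n log n)/2`, so Stirling's `n log n - n` keeps half of `n log n`. The threshold 8
  -- serves here, as `log 8 = 3 log 2 > 2`.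
  have h2 : 2 ≤ Real.log n := by
    have h3 : Real.log 8 ≤ Real.log n := Real.log_le_log (by norm_num) hn'
    have h4 : Real.log 8 = 3 * Real.log 2 := by
      rw [show (8 : ℝ) = 2 ^ 3 by norm_num, Real.log_pow]; norm_num
    linarith [Real.log_two_gt_d9]
  have h5 : 0 ≤ Real.log (2 * Real.pi) :=
    Real.log_nonneg (by linarith [Real.pi_gt_three])
  unfold Real.logb
  rw [← mul_div_assoc, ← mul_div_assoc]
  refine div_le_div_of_nonneg_right ?_ (Real.log_nonneg one_le_two)
  nlinarith

theorem IsScattering.le_bitComplexity (hB : B.IsScattering) {n : ℕ} (hn : 8 ≤ n) :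
    ENNReal.ofReal (n * Real.logb 2 n) ≤ 2 * B.bitComplexity n := by
  have h := (hB.symmetryBits_le (gathered n)).trans
    (le_iSup (fun x₀ : Placement n => ∫⁻ ω, B.bitsToScatter ω ∂(B.execution x₀)) (gathered n))
  rw [symmetryBits_gathered] at h
  calc ENNReal.ofReal (n * Real.logb 2 n)
      ≤ ENNReal.ofReal (2 * Real.logb 2 n.factorial) :=
        ENNReal.ofReal_le_ofReal (logb_factorial_ge hn)
    _ = 2 * ENNReal.ofReal (Real.logb 2 n.factorial) := by
        rw [ENNReal.ofReal_mul zero_le_two, ENNReal.ofReal_ofNat]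
    _ ≤ 2 * B.bitComplexity n := by gcongr; exact h

end Algorithm

end Robots

/-! ### Comparison of the two bounds. -/

theorem mainTheorem2 (A : Robots.Algorithm) (hcan : A.IsCanonical) (hscat : A.IsScattering)
    (K n₀ : ℕ) (c : ℝ)
    (hk : ∀ (C : Multiset Robots.Plane) (P : Robots.Plane), n₀ ≤ C.card → P ∈ C →
      (A.numDest C P : ℝ) ≤ c * (C.card : ℝ) ^ K) :
    (∃ c' : ℝ, ∀ n : ℕ, n₀ ≤ n →
      A.bitComplexity n ≤ ENNReal.ofReal (c' * ((n : ℝ) * Real.logb 2 n))) ∧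
    A.RandomBitOptimal := by
  obtain ⟨c', hc'⟩ := hcan.exists_bitComplexity_le hk
  refine ⟨⟨c', hc'⟩, fun B hB => ⟨Real.toNNReal c' * 2, max n₀ 8, fun n hn => ?_⟩⟩
  have hlog : 0 ≤ (n : ℝ) * Real.logb 2 n :=
    mul_nonneg n.cast_nonneg (div_nonneg (Real.log_natCast_nonneg n) (Real.log_nonneg one_le_two))
  calc A.bitComplexity n ≤ ENNReal.ofReal (c' * ((n : ℝ) * Real.logb 2 n)) :=
        hc' n ((le_max_left _ _).trans hn)
    _ = ENNReal.ofReal c' * ENNReal.ofReal ((n : ℝ) * Real.logb 2 n) :=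
        ENNReal.ofReal_mul' hlog
    _ ≤ ENNReal.ofReal c' * (2 * B.bitComplexity n) := by
        gcongr
        exact hB.le_bitComplexity ((le_max_right _ _).trans hn)
    _ = (Real.toNNReal c' * 2 : ℝ≥0) * B.bitComplexity n := by
        rw [ENNReal.coe_mul, mul_assoc]
        rfl
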